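/- Let $K$ be an ordinary differential field with derivation $\partial$, let $n\ge 1$, and let $X=\{x_1,\dots,x_n\}$ and $U=\{u_1,\dots,u_{n-1}\}$ be differential indeterminates; write $x_{ik}=\partial^k x_i$, $u_{jk}=\partial^k u_j$. Consider a system $\mathcal P(X,U)$ of $n$ linear differential polynomial parametric equations in $n-1$ differential parameters, $$x_i=P_i(U),\qquad P_i\in K\{U\},\ \deg P_i\le 1,\qquad i=1,\dots,n .$$ Write $P_i=a_i-H_i(U)$ with $a_i\in K$ and $H_i$ homogeneous of degree one (or zero), and put $F_i=x_i-a_i+H_i(U)\in K\{X\}\{U\}$. Let $\mathrm{ID}=\{f\in K\{X\} : f(P_1(U),\dots,P_n(U))=0\}$ be the implicit ideal. *Resultants.* Let $f_1,\dots,f_n$ be linear differential polynomials in $u_1,\dots,u_{n-1}$ over a differential ring $D$. Let $\operatorname{ord}(f_i,u_j)$ be the largest $k$ such that $u_{jk}$ occurs in $f_i$ ($-1$ if there is none), let $o_i\ge 0$ be the order of $f_i$ ($0$ if $f_i\in D$), and put $N=\sum_i o_i$, $\gamma_j=\min_i\,(o_i-\operatorname{ord}(f_i,u_j))$, $\gamma=\sum_{j}\gamma_j$.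 The linear complete differential resultant $\partial\mathrm{CRes}(f_1,\dots,f_n)\in D$ is the determinant of the matrix of coefficients of the polynomials $\partial^k f_i$, $0\le k\le N-o_i-\gamma$ (listed by increasing $i$, then decreasing $k$), with respect to $u_{jk}$, $0\le k\le N-\gamma_j-\gamma$ (listed by decreasing $k$, then decreasing $j$), followed by the monomial $1$. For homogeneous $h_1,\dots,h_n$, the homogeneous resultant $\partial\mathrm{CRes}^h(h_1,\dots,h_n)$ is the determinant of the matrix of coefficients of the $\partial^k h_i$, $0\le k\le N-o_i-\gamma-1$, with respect to the $u_{jk}$, $0\le k\le N-\gamma_j-\gamma-1$. (If such a matrix is not square, the resultant is taken to be $0$; the determinant of an empty matrix is $1$.) The numbers $N,\gamma_j,\gamma$ are the same for $F_1,\dots,F_n$ and for $H_1,\dots,H_n$. **Theorem.** 1. Suppose that every parameter $u_j$ is among the variables used in $\partial\mathrm{CRes}^h(H_1,\dots,H_n)$, i.e. $\gamma_j+\gamma<N$ for all $j$. If $\partial\mathrm{CRes}^h(H_1,\dots,H_n)\ne 0$, then $\mathrm{ID}$ has differential dimension $n-1$, and $\partial\mathrm{CRes}(F_1,\dots,F_n)(X)=0$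 is the implicit equation of $\mathcal P(X,U)$. 2. Suppose that every parameter $u_j$ is among the variables used in $\partial\mathrm{CRes}(F_1,\dots,F_n)$, i.e. $\gamma_j+\gamma\le N$ for all $j$. If $\partial\mathrm{CRes}(F_1,\dots,F_n)\ne 0$, then the same two conclusions hold. Here the differential dimension of $\mathrm{ID}$ is the largest number of indeterminates among $x_1,\dots,x_n$ that are differentially independent modulo $\mathrm{ID}$. That $A(X)=0$ is the implicit equation means that $A$ is a characteristic polynomial of $\mathrm{ID}$: $A$ is irreducible and, for every ranking on $X$, $\{A\}$ is a characteristic set of $\mathrm{ID}$ (an autoreduced set of lowest rank among those contained in $\mathrm{ID}$). -/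

import Mathlib

namespace DiffAlg

open MvPolynomial
open scoped Differential

noncomputable section

/-! ### Differential polynomials -/

/-- The ring `R{Y}` of ordinary differential polynomials in the differential indeterminates
`y_s`, `s : σ`: the polynomial ring in the variables `y_{s,k} = X (s, k)`, `k : ℕ`, where
`y_{s,k}` stands for the `k`-th derivative of `y_s`. -/
abbrev DiffPoly (σ R : Type*) [CommRing R] := MvPolynomial (σ × ℕ) R

/-- Apply the derivation of `R` to every coefficient. -/
def coeffDeriv {ι R : Type*} [CommRing R] [Differential R] (f : MvPolynomial ι R) :
    MvPolynomial ι R :=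
  ∑ s ∈ f.support, monomial s (coeff s f)′

theorem coeff_coeffDeriv {ι R : Type*} [CommRing R] [Differential R] (f : MvPolynomial ι R)
    (s : ι →₀ ℕ) : coeff s (coeffDeriv f) = (coeff s f)′ := by
  classical
  simp only [coeffDeriv, coeff_sum, coeff_monomial, Finset.sum_ite_eq']
  split_ifs with h
  · rfl
  · rw [notMem_support_iff.mp h, map_zero]

theorem coeffDeriv_add {ι R : Type*} [CommRing R] [Differential R] (f g : MvPolynomial ι R) :
    coeffDeriv (f + g) = coeffDeriv f + coeffDeriv g := by
  ext s
  simp [coeff_coeffDeriv]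

theorem coeffDeriv_mul {ι R : Type*} [CommRing R] [Differential R] (f g : MvPolynomial ι R) :
    coeffDeriv (f * g) = f * coeffDeriv g + g * coeffDeriv f := by
  classical
  ext s
  simp only [coeff_coeffDeriv, coeff_add, mul_comm g, coeff_mul, map_sum, Derivation.leibniz,
    smul_eq_mul, Finset.sum_add_distrib]
  congr 1
  exact Finset.sum_congr rfl fun _ _ => mul_comm _ _

/-- `coeffDeriv` as a derivation. -/
def coeffDerivation (ι R : Type*) [CommRing R] [Differential R] :
    Derivation ℤ (MvPolynomial ι R) (MvPolynomial ι R) :=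
  Derivation.mk' (AddMonoidHom.mk' coeffDeriv coeffDeriv_add).toIntLinearMap
    fun f g => by simpa using coeffDeriv_mul f g

/-- The derivation of `R{Y}`: it extends the one of `R` and maps `y_{s,k}` to `y_{s,k+1}`. -/
instance instDifferentialDiffPoly (σ R : Type*) [CommRing R] [Differential R] :
    Differential (DiffPoly σ R) where
  deriv := coeffDerivation (σ × ℕ) R +
    (mkDerivation R fun v : σ × ℕ => (X (v.1, v.2 + 1) : DiffPoly σ R)).restrictScalars ℤ

theorem deriv_C {σ R : Type*} [CommRing R] [Differential R] (a : R) :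
    (C a : DiffPoly σ R)′ = C a′ := by
  classical
  have h : coeffDeriv (C a : DiffPoly σ R) = C a′ := by
    ext s
    rw [coeff_coeffDeriv, coeff_C, coeff_C]
    split_ifs <;> simp
  change coeffDeriv (C a : DiffPoly σ R) + mkDerivation R _ (C a) = _
  rw [h, show C a = algebraMap R (DiffPoly σ R) a from rfl, Derivation.map_algebraMap, add_zero]

theorem deriv_X {σ R : Type*} [CommRing R] [Differential R] (v : σ × ℕ) :
    (X v : DiffPoly σ R)′ = X (v.1, v.2 + 1) := by
  classical
  have h : coeffDeriv (X v : DiffPoly σ R) = 0 := by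
    ext s
    rw [coeff_coeffDeriv, coeff_X]
    split_ifs <;> simp
  change coeffDeriv (X v : DiffPoly σ R) + mkDerivation R _ (X v) = _
  rw [h, mkDerivation_X, zero_add]

/-- `ord(f, y_s)`: the largest `k` such that `y_{s,k}` occurs in `f`, and `-1` if none does. -/
def ordIn {σ R : Type*} [DecidableEq σ] [CommRing R] (f : DiffPoly σ R) (s : σ) : ℤ :=
  (((f.vars.filter fun v => v.1 = s).sup fun v => v.2 + 1 : ℕ) : ℤ) - 1

/-- The order of a differential polynomial: the largest `k` such that some `y_{s,k}` occurs in it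
(`0` for an element of the ground ring). -/
def order {σ R : Type*} [CommRing R] (f : DiffPoly σ R) : ℕ :=
  f.vars.sup fun v => v.2

/-! ### Linear complete differential resultants

Below, `f` is a family of `n = m + 1` linear differential polynomials in the `m = n - 1`
differential indeterminates `u_j`, `j : Fin m`, over a differential ring `D`. -/

section Resultant

variable {D : Type*} [CommRing D] {m : ℕ}

/-- `N = ∑ o_i`. -/
def totalOrder (f : Fin (m + 1) → DiffPoly (Fin m) D) : ℤ :=
  ∑ i, (order (f i) : ℤ)

/-- `γ_j = min_i (o_i - ord(f_i, u_j))`. -/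
def gammaAt (f : Fin (m + 1) → DiffPoly (Fin m) D) (j : Fin m) : ℤ :=
  Finset.univ.inf' Finset.univ_nonempty fun i => (order (f i) : ℤ) - ordIn (f i) j

/-- The completeness index `γ = ∑ γ_j`. -/
def gamma (f : Fin (m + 1) → DiffPoly (Fin m) D) : ℤ :=
  ∑ j, gammaAt f j

/-- The index set of the rows: the pairs `(i, k)` with `0 ≤ k ≤ N - o_i - γ - s`, standing for
`∂^k f_i`. The order is increasing in `i`, then decreasing in `k`.
`s = 0` is for the resultant, `s = 1` for the homogeneous one. -/
def rowSet (f : Fin (m + 1) → DiffPoly (Fin m) D) (s : ℤ) : Finset (Fin (m + 1) ×ₗ ℕᵒᵈ) :=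
  Finset.univ.biUnion fun i =>
    (Finset.range (totalOrder f - order (f i) - gamma f - s + 1).toNat).image fun k =>
      toLex (i, OrderDual.toDual k)

/-- The set of variables `u_{j,k}` with `0 ≤ k ≤ N - γ_j - γ - s`, listed in decreasing order
for the orderly ranking with `u_1 < ⋯ < u_{n-1}`. -/
def varSet (f : Fin (m + 1) → DiffPoly (Fin m) D) (s : ℤ) : Finset (ℕᵒᵈ ×ₗ (Fin m)ᵒᵈ) :=
  Finset.univ.biUnion fun j =>
    (Finset.range (totalOrder f - gammaAt f j - gamma f - s + 1).toNat).image fun k =>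
      toLex (OrderDual.toDual k, OrderDual.toDual j)

/-- The determinant of the matrix with rows in `S` and columns in `T`, both listed increasingly.
It is `0` if the matrix is not square. -/
def orderedDet {α β R : Type*} [LinearOrder α] [LinearOrder β] [CommRing R]
    (S : Finset α) (T : Finset β) (M : α → β → R) : R :=
  if h : S.card = T.card then
    Matrix.det (Matrix.of fun a b : Fin T.card =>
      M (S.orderIsoOfFin h a) (T.orderIsoOfFin rfl b))
  else 0

variable [Differential D]

/-- The polynomial `∂^k f_i` of a row. -/
def rowPoly (f : Fin (m + 1) → DiffPoly (Fin m) D) (r : Fin (m + 1) ×ₗ ℕᵒᵈ) :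
    DiffPoly (Fin m) D :=
  (fun p : DiffPoly (Fin m) D => p′)^[OrderDual.ofDual (ofLex r).2] (f (ofLex r).1)

/-- The coefficient in `p` of the variable `u_{j,k}` of a column. -/
def varCoeff (p : DiffPoly (Fin m) D) (c : ℕᵒᵈ ×ₗ (Fin m)ᵒᵈ) : D :=
  coeff (Finsupp.single (OrderDual.ofDual (ofLex c).2, OrderDual.ofDual (ofLex c).1) 1) p

/-- The coefficient in `p` of the variable or of the monomial `1` (the column `⊤`). -/
def colCoeff (p : DiffPoly (Fin m) D) : WithTop (ℕᵒᵈ ×ₗ (Fin m)ᵒᵈ) → D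
  | ⊤ => constantCoeff p
  | (c : ℕᵒᵈ ×ₗ (Fin m)ᵒᵈ) => varCoeff p c

/-- The linear complete differential resultant `∂CRes(f_1, …, f_n)`: the determinant of the
coefficient matrix of the `∂^k f_i`, `k ≤ N - o_i - γ`, with respect to the variables `u_{j,k}`,
`k ≤ N - γ_j - γ`, and `1` (in the last column). -/
def cres (f : Fin (m + 1) → DiffPoly (Fin m) D) : D :=
  orderedDet (rowSet f 0) (insert ⊤ ((varSet f 0).image WithTop.some))
    fun r c => colCoeff (rowPoly f r) c

/-- The linear complete differential homogeneous resultant `∂CRes^h(h_1, …, h_n)`: the determinant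
of the coefficient matrix of the `∂^k h_i`, `k ≤ N - o_i - γ - 1`, with respect to the variables
`u_{j,k}`, `k ≤ N - γ_j - γ - 1`. -/
def cresHom (h : Fin (m + 1) → DiffPoly (Fin m) D) : D :=
  orderedDet (rowSet h 1) (varSet h 1) fun r c => varCoeff (rowPoly h r) c

end Resultant

/-! ### Linear systems of differential polynomial parametric equations -/

section System

variable {K : Type*} [Field K] {m : ℕ}

/-- `H_i(U) = a_i - P_i(U)`, where `a_i` is the constant term of `P_i`. -/
def homPart (P : Fin (m + 1) → DiffPoly (Fin m) K) (i : Fin (m + 1)) : DiffPoly (Fin m) K :=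
  C (constantCoeff (P i)) - P i

/-- `F_i(X, U) = (x_i - a_i) + H_i(U)` as an element of `K{X}{U}`. -/
def eqPoly (P : Fin (m + 1) → DiffPoly (Fin m) K) (i : Fin (m + 1)) :
    DiffPoly (Fin m) (DiffPoly (Fin (m + 1)) K) :=
  C (X (i, 0) - C (constantCoeff (P i))) + MvPolynomial.map C (homPart P i)

/-- The implicit ideal: all `f` in `K{X}` with `f(P_1(U), …, P_n(U)) = 0`, where `x_{i,k}` is
replaced by `∂^k P_i`. -/
def implicitIdeal [Differential K] (P : Fin (m + 1) → DiffPoly (Fin m) K) :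
    Ideal (DiffPoly (Fin (m + 1)) K) :=
  RingHom.ker (aeval fun v : Fin (m + 1) × ℕ =>
    (fun p : DiffPoly (Fin m) K => p′)^[v.2] (P v.1) :
      DiffPoly (Fin (m + 1)) K →ₐ[K] DiffPoly (Fin m) K)

end System

/-! ### Rankings, characteristic sets, dimension -/

/-- A ranking on the differential indeterminates `x_s`, `s : σ`: a total order on the set of their
derivatives such that `v < ∂v`, and `v < w` implies `∂v < ∂w`. -/
structure Ranking (σ : Type*) where
  /-- the strict order -/
  lt : σ × ℕ → σ × ℕ → Prop
  irrefl : ∀ v, ¬ lt v v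
  trans : ∀ u v w, lt u v → lt v w → lt u w
  total : ∀ v w, lt v w ∨ v = w ∨ lt w v
  lt_deriv : ∀ v, lt v (v.1, v.2 + 1)
  deriv_lt : ∀ v w, lt v w → lt (v.1, v.2 + 1) (w.1, w.2 + 1)

section CharSet

variable {σ K : Type*} [Field K] (rk : Ranking σ)

/-- `v` is the leader of `f`: the highest derivative that occurs in `f`. -/
def IsLeader (f : DiffPoly σ K) (v : σ × ℕ) : Prop :=
  v ∈ f.vars ∧ ∀ w ∈ f.vars, w = v ∨ rk.lt w v

/-- `f` has lower rank than `g`: `f` is an element of `K` and `g` is not; or the leader of `f` is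
lower than that of `g`; or the leaders agree and `f` has lower degree in the leader. -/
def RankLT (f g : DiffPoly σ K) : Prop :=
  (f.vars = ∅ ∧ g.vars ≠ ∅) ∨
    ∃ v w, IsLeader rk f v ∧ IsLeader rk g w ∧
      (rk.lt v w ∨ (v = w ∧ degreeOf v f < degreeOf v g))

/-- `f` and `g` have the same rank. -/
def RankEq (f g : DiffPoly σ K) : Prop :=
  (f.vars = ∅ ∧ g.vars = ∅) ∨
    ∃ v, IsLeader rk f v ∧ IsLeader rk g v ∧ degreeOf v f = degreeOf v g

/-- `f` is reduced with respect to `g`: `g` is not in `K`, no proper derivative of the leader `v`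
of `g` occurs in `f`, and `f` has lower degree in `v` than `g`. -/
def IsReduced (f g : DiffPoly σ K) : Prop :=
  ∃ v, IsLeader rk g v ∧ (∀ l : ℕ, 0 < l → (v.1, v.2 + l) ∉ f.vars) ∧
    degreeOf v f < degreeOf v g

/-- A chain (autoreduced set): nonzero differential polynomials `A_1, …, A_r`, listed by
increasing rank, with `A_j` reduced with respect to `A_i` for `i < j`. -/
def IsChain (A : List (DiffPoly σ K)) : Prop :=
  (∀ f ∈ A, f ≠ 0) ∧ A.Pairwise fun f g => RankLT rk f g ∧ IsReduced rk g f

/-- Ritt's comparison of chains: `A` is lower than `B`. -/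
def ChainLT (A B : List (DiffPoly σ K)) : Prop :=
  (∃ (k : ℕ) (hA : k < A.length) (hB : k < B.length),
      (∀ (i : ℕ) (hi : i < k), RankEq rk (A[i]'(hi.trans hA)) (B[i]'(hi.trans hB))) ∧
        RankLT rk A[k] B[k]) ∨
    ∃ h : B.length < A.length,
      ∀ (i : ℕ) (hi : i < B.length), RankEq rk (A[i]'(hi.trans h)) B[i]

/-- A characteristic set of `I`: a chain of lowest rank among the chains contained in `I`. -/
def IsCharacteristicSet (I : Ideal (DiffPoly σ K)) (A : List (DiffPoly σ K)) : Prop :=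
  (IsChain rk A ∧ ∀ f ∈ A, f ∈ I) ∧
    ∀ B : List (DiffPoly σ K), IsChain rk B → (∀ f ∈ B, f ∈ I) → ¬ ChainLT rk B A

/-- `A` is a characteristic polynomial of `I`: it is irreducible, and `{A}` is a characteristic
set of `I`. -/
def IsCharacteristicPolynomial (I : Ideal (DiffPoly σ K)) (A : DiffPoly σ K) : Prop :=
  Irreducible A ∧ IsCharacteristicSet rk I [A]

end CharSet

/-- The differential dimension of a (prime differential) ideal `I` of `K{X}`: the largest number
of differential indeterminates among `x_s`, `s : σ`, that are differentially independent modulo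
`I`, i.e. such that no nonzero element of `I` involves only their derivatives. -/
def diffDim {σ K : Type*} [Fintype σ] [Field K] (I : Ideal (DiffPoly σ K)) : ℕ :=
  open Classical in
  (Finset.univ.filter fun Y : Finset σ =>
    ∀ f ∈ I, (∀ v ∈ f.vars, v.1 ∈ Y) → f = 0).sup Finset.card

/-- The implicit ideal `ID` of the system `x_i = P_i(U)`, `i = 1, …, m + 1`, has dimension `m`, and
`A(X) = 0` is its implicit equation, i.e. `A` is a characteristic polynomial of `ID`
(for every ranking on `X`). -/
def IsImplicitEquation {K : Type*} [Field K] [Differential K] {m : ℕ}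
    (P : Fin (m + 1) → DiffPoly (Fin m) K) (A : DiffPoly (Fin (m + 1)) K) : Prop :=
  diffDim (implicitIdeal P) = m ∧
    ∀ rk : Ranking (Fin (m + 1)), IsCharacteristicPolynomial rk (implicitIdeal P) A

end

end DiffAlg

/-!
Translating by the constant terms, the system becomes the family of linear differential forms
`h_i`, and the substitution `x_{i,k} ↦ ∂^k h_i` is a `K`-linear map `prolong h` from the span of
the `x_{i,k}` to the span of the `u_{j,l}` that commutes with `∂`. Its kernel consists of the
syzygies of the `h_i`. The implicit ideal is governed by them: `eq_zero_of_mem_implicitIdeal`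
shows that it has no nonzero element in a set of variables which supports no nontrivial syzygy.

Expanding `∂CRes(F_1, …, F_n)` along its last column, the only one that involves the `x_{i,k}`,
gives the linear polynomial of a syzygy `resVec P` whose coefficients are cofactors in `K`. If it
does not vanish, then the other columns have full rank, that is, `prolong h` maps the forms in the
row variables onto the forms in the column variables, with one-dimensional kernel spanned by
`resVec P`. Since all `u_j` are among the column variables, surjectivity persists when all bounds
are raised by `q` (`supported_below_le_map_prolong_add`), and the kernel then has dimension
`q + 1`. The derivatives `∂^l (resVec P)`, `l ≤ q`, lie in it and have distinct orders in each `x_i`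
that occurs, so a syzygy of lower order in `x_i` must vanish (`eq_zero_of_prolong_eq_zero`).
Applied to the leader of the resultant for a given ranking, this leaves no chain in the implicit
ideal that is lower than the resultant; it also shows that all indeterminates but `x_i` are
independent modulo the ideal, which gives the dimension (`isImplicitEquation_of_prolong_eq_zero`).

If the homogeneous resultant does not vanish, then surjectivity holds with all bounds lowered by
one, hence also with the original ones, and a syzygy in the row variables exists by counting. Its
nonzero coefficients belong to rows with a nonzero cofactor, so `∂CRes(F_1, …, F_n) ≠ 0`
(`cres_ne_zero_of_cresHom_ne_zero`), and the first part follows from the second.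
-/

namespace DiffAlg

open MvPolynomial
open scoped Differential

noncomputable section

/-! ### Linear forms in the derivatives -/

section LinearForms

variable {σ τ R : Type*} [CommRing R]

/-- The homogeneous linear polynomial with the coefficient vector `c`. -/
def linForm : (τ →₀ R) →ₗ[R] MvPolynomial τ R := Finsupp.linearCombination R X

@[simp]
theorem linForm_single (v : τ) (a : R) : linForm (Finsupp.single v a) = C a * X v := by
  simp [linForm, MvPolynomial.smul_eq_C_mul]

theorem coeff_linForm (c : τ →₀ R) (v : τ) : coeff (Finsupp.single v 1) (linForm c) = c v := by
  classical
  induction c using Finsupp.induction_linear with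
  | zero => simp
  | add f g hf hg => simp [hf, hg]
  | single w a =>
    rw [linForm_single, coeff_C_mul, coeff_X, Finsupp.single_apply]
    simp [Finsupp.single_left_inj]

@[simp]
theorem constantCoeff_linForm (c : τ →₀ R) : constantCoeff (linForm c) = 0 := by
  induction c using Finsupp.induction_linear with
  | zero => simp
  | add f g hf hg => simp [hf, hg]
  | single w a => simp

theorem totalDegree_linForm_le (c : τ →₀ R) : (linForm c).totalDegree ≤ 1 := by
  rw [linForm, Finsupp.linearCombination_apply]
  refine totalDegree_finsetSum_le fun v _ => ?_
  exact (totalDegree_smul_le ..).trans ((totalDegree_monomial_le ..).trans (by simp))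

theorem mem_vars_C_add_linForm (a : R) (c : τ →₀ R) (v : τ) (hv : c v ≠ 0) :
    v ∈ (C a + linForm c).vars := by
  classical
  rw [mem_vars_iff_mem_support]
  refine ⟨Finsupp.single v 1, ?_, by simp⟩
  rw [mem_support_iff, coeff_add, coeff_linForm, coeff_C,
    if_neg (Finsupp.single_ne_zero.mpr one_ne_zero).symm, zero_add]
  exact hv

theorem map_linForm {S : Type*} [CommRing S] (f : R →+* S) (c : τ →₀ R) :
    map f (linForm c) = linForm (c.mapRange f f.map_zero) := by
  induction c using Finsupp.induction_linear with
  | zero => simp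
  | add c d hc hd => rw [map_add, map_add, hc, hd, ← map_add, ← Finsupp.mapRange_add (by simp)]
  | single w a => simp

/-- A polynomial of degree at most one is a constant plus a linear form. -/
theorem exists_eq_C_add_linForm (p : MvPolynomial τ R) (hp : p.totalDegree ≤ 1) :
    ∃ c, p = C (constantCoeff p) + linForm c := by
  classical
  suffices h : ∃ a c, p = C a + linForm c by
    obtain ⟨a, c, rfl⟩ := h
    exact ⟨c, by simp⟩
  rw [p.as_sum]
  refine Finset.sum_induction _ (fun q => ∃ a c, q = C a + linForm c) ?_ ⟨0, 0, by simp⟩ ?_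
  · rintro _ _ ⟨a, c, rfl⟩ ⟨b, d, rfl⟩
    exact ⟨a + b, c + d, by simp only [map_add]; ring⟩
  · intro s hs
    rcases Nat.le_one_iff_eq_zero_or_eq_one.mp ((le_totalDegree hs).trans hp) with h | h
    · rw [Finsupp.sum, Finset.sum_eq_zero_iff] at h
      have h0 : s = 0 := Finsupp.ext fun v => by
        by_contra hv
        exact hv (h v (Finsupp.mem_support_iff.mpr hv))
      exact ⟨coeff s p, 0, by simp [h0]⟩
    · obtain ⟨v, rfl⟩ := (Finsupp.sum_eq_one_iff s).mp h
      exact ⟨0, Finsupp.single v (coeff _ p), by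
        rw [linForm_single, map_zero, zero_add, C_mul_X_eq_monomial]⟩

variable [Differential R]

/-- The derivation of `R{Y}` on the coefficient vectors of linear forms. -/
def formDeriv : (σ × ℕ →₀ R) →+ (σ × ℕ →₀ R) :=
  Finsupp.mapRange.addMonoidHom (Differential.deriv (R := R)).toLinearMap.toAddMonoidHom +
    Finsupp.mapDomain.addMonoidHom fun v : σ × ℕ => (v.1, v.2 + 1)

@[simp]
theorem formDeriv_single (v : σ × ℕ) (a : R) :
    formDeriv (Finsupp.single v a) = Finsupp.single v a′ + Finsupp.single (v.1, v.2 + 1) a := by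
  simp [formDeriv]

theorem formDeriv_smul (a : R) (c : σ × ℕ →₀ R) :
    formDeriv (a • c) = a′ • c + a • formDeriv c := by
  induction c using Finsupp.induction_linear with
  | zero => simp
  | add c d hc hd => simp only [smul_add, map_add, hc, hd]; abel
  | single v b =>
    simp only [Finsupp.smul_single, formDeriv_single, smul_eq_mul, Derivation.leibniz,
      smul_add, Finsupp.single_add, mul_comm b]
    abel

theorem formDeriv_apply_zero (c : σ × ℕ →₀ R) (s : σ) : formDeriv c (s, 0) = (c (s, 0))′ := by
  classical
  induction c using Finsupp.induction_linear with
  | zero => simp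
  | add c d hc hd => simp [hc, hd]
  | single v b =>
    simp only [formDeriv_single, Finsupp.add_apply, Finsupp.single_apply, Prod.mk.injEq,
      Nat.add_one_ne_zero, and_false, if_false, add_zero]
    split_ifs <;> simp

theorem formDeriv_apply_succ (c : σ × ℕ →₀ R) (s : σ) (k : ℕ) :
    formDeriv c (s, k + 1) = (c (s, k + 1))′ + c (s, k) := by
  classical
  induction c using Finsupp.induction_linear with
  | zero => simp
  | add c d hc hd => simp only [map_add, Finsupp.add_apply, hc, hd]; abel
  | single v b =>
    obtain ⟨t, l⟩ := v
    simp only [formDeriv_single, Finsupp.add_apply, Finsupp.single_apply, Prod.mk.injEq,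
      Nat.add_right_cancel_iff]
    split_ifs <;> simp

/-- A bound `l + A ≤ B` on the order in `y_s` grows by `q` under `q` differentiations. The bound is
stated with two numbers to allow for `A > B`, when `y_s` does not occur. -/
theorem formDeriv_iterate_apply_eq_zero (c : σ × ℕ →₀ R) (s : σ) (A B : ℕ)
    (hc : ∀ l, B < l + A → c (s, l) = 0) (q l : ℕ) (hl : B + q < l + A) :
    (formDeriv^[q] c) (s, l) = 0 := by
  induction q generalizing l with
  | zero => exact hc l hl
  | succ q ih =>
    rw [Function.iterate_succ_apply']
    cases l with
    | zero => rw [formDeriv_apply_zero, ih 0 (by omega), map_zero]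
    | succ l => rw [formDeriv_apply_succ, ih _ (by omega), ih _ (by omega), map_zero, add_zero]

/-- The leading coefficient in `y_s` is unchanged under differentiation. -/
theorem formDeriv_iterate_apply_top (c : σ × ℕ →₀ R) (s : σ) (k : ℕ)
    (hc : ∀ l, k < l → c (s, l) = 0) (q : ℕ) : (formDeriv^[q] c) (s, k + q) = c (s, k) := by
  induction q with
  | zero => rfl
  | succ q ih =>
    rw [Function.iterate_succ_apply', ← add_assoc, formDeriv_apply_succ, ih,
      formDeriv_iterate_apply_eq_zero c s 0 k hc _ _ (by omega), map_zero, zero_add]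

theorem deriv_linForm (c : σ × ℕ →₀ R) :
    (linForm c : DiffPoly σ R)′ = linForm (formDeriv c) := by
  induction c using Finsupp.induction_linear with
  | zero => simp
  | add c d hc hd => simp only [map_add, hc, hd]
  | single v a =>
    rw [linForm_single, Derivation.leibniz, deriv_C, deriv_X, formDeriv_single, map_add,
      linForm_single, linForm_single, smul_eq_mul, smul_eq_mul]
    ring

theorem deriv_iterate_C_add_linForm (a : R) (c : σ × ℕ →₀ R) (k : ℕ) :
    (fun p : DiffPoly σ R => p′)^[k] (C a + linForm c) =
      C ((fun x : R => x′)^[k] a) + linForm (formDeriv^[k] c) := by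
  induction k with
  | zero => rfl
  | succ k ih =>
    simp only [Function.iterate_succ_apply', ih, map_add, deriv_C, deriv_linForm]

theorem deriv_iterate_X (s : σ) (k : ℕ) :
    (fun p : DiffPoly σ R => p′)^[k] (X (s, 0)) = X (s, k) := by
  induction k with
  | zero => rfl
  | succ k ih => simp only [Function.iterate_succ_apply', ih, deriv_X]

theorem deriv_iterate_C (a : R) (k : ℕ) :
    (fun p : DiffPoly σ R => p′)^[k] (C a) = C ((fun x : R => x′)^[k] a) := by
  induction k with
  | zero => rfl
  | succ k ih => simp only [Function.iterate_succ_apply', ih, deriv_C]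

/-- Differentiation commutes with a homomorphism of differential rings on the coefficients. -/
theorem formDeriv_iterate_mapRange {S : Type*} [CommRing S] [Differential S] (f : R →+* S)
    (hf : ∀ a, f a′ = (f a)′) (c : σ × ℕ →₀ R) (k : ℕ) :
    formDeriv^[k] (c.mapRange f f.map_zero) = (formDeriv^[k] c).mapRange f f.map_zero := by
  have h1 (c : σ × ℕ →₀ R) :
      formDeriv (c.mapRange f f.map_zero) = (formDeriv c).mapRange f f.map_zero := by
    induction c using Finsupp.induction_linear with
    | zero => simp
    | add c d hc hd =>
      rw [Finsupp.mapRange_add (by simp), map_add, map_add, Finsupp.mapRange_add (by simp), hc, hd]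
    | single v a => simp [Finsupp.mapRange_add (map_add f), hf]
  induction k with
  | zero => rfl
  | succ k ih => rw [Function.iterate_succ_apply', ih, h1, Function.iterate_succ_apply']

end LinearForms

/-! ### Determinants with rows and columns indexed by finite sets -/

section OrderedDet

variable {α β R : Type*} [LinearOrder α] [LinearOrder β] [CommRing R]
  {S : Finset α} {T : Finset β}

/-- The matching of columns with rows by their positions. -/
def colEquivRow (h : S.card = T.card) : T ≃ S :=
  (T.orderIsoOfFin rfl).symm.toEquiv.trans (S.orderIsoOfFin h).toEquiv

theorem orderedDet_eq_det (h : S.card = T.card) (M : α → β → R) :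
    orderedDet S T M = Matrix.det (Matrix.of fun a b : T => M (colEquivRow h a) b) := by
  rw [orderedDet, dif_pos h, ← Matrix.det_submatrix_equiv_self (T.orderIsoOfFin rfl).toEquiv]
  congr 1
  ext a b
  simp [colEquivRow]

theorem orderedDet_map {R' : Type*} [CommRing R'] (f : R →+* R') (M : α → β → R) :
    orderedDet S T (fun a b => f (M a b)) = f (orderedDet S T M) := by
  by_cases h : S.card = T.card
  · rw [orderedDet_eq_det h, orderedDet_eq_det h, RingHom.map_det]
    rfl
  · rw [orderedDet, dif_neg h, orderedDet, dif_neg h, map_zero]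

/-- Laplace expansion along the column `t`. The cofactors are written as determinants in which
the column `t` is a unit vector. -/
theorem orderedDet_update_col {t : β} (ht : t ∈ T) (M : α → β → R) (x : α → R) :
    orderedDet S T (fun a => Function.update (M a) t (x a)) =
      ∑ a ∈ S, x a * orderedDet S T fun a' =>
        Function.update (M a') t ((Pi.single a 1 : α → R) a') := by
  by_cases h : S.card = T.card
  · let A : Matrix T T R := Matrix.of fun a b => M (colEquivRow h a) b
    have key (y : α → R) : orderedDet S T (fun a => Function.update (M a) t (y a)) =
        ∑ s : T, A.adjugate ⟨t, ht⟩ s * y (colEquivRow h s) := by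
      trans A.cramer (fun s => y (colEquivRow h s)) ⟨t, ht⟩
      · rw [Matrix.cramer_apply, orderedDet_eq_det h]
        congr 1
        ext a b
        simp [Matrix.updateCol_apply, Function.update_apply, A, Subtype.ext_iff]
      · rw [Matrix.cramer_eq_adjugate_mulVec]
        rfl
    rw [key, ← Finset.sum_coe_sort S, ← (colEquivRow h).sum_comp]
    refine Finset.sum_congr rfl fun s _ => ?_
    rw [key, Finset.sum_eq_single s]
    · simp [mul_comm]
    · intro s' _ hs'
      rw [Pi.single_eq_of_ne, mul_zero]
      exact fun e => hs' ((colEquivRow h).injective (Subtype.ext e))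
    · simp
  · simp [orderedDet, dif_neg h]

theorem orderedDet_eq_zero_of_col_eq {t t' : β} (ht : t ∈ T) (ht' : t' ∈ T) (hne : t ≠ t')
    (M : α → β → R) (hM : ∀ a, M a t = M a t') : orderedDet S T M = 0 := by
  by_cases h : S.card = T.card
  · rw [orderedDet_eq_det h]
    exact Matrix.det_zero_of_column_eq (i := ⟨t, ht⟩) (j := ⟨t', ht'⟩) (by simpa using hne)
      fun a => hM _
  · rw [orderedDet, dif_neg h]

theorem orderedDet_ne_zero_iff {F : Type*} [Field F] (M : α → β → F) :
    orderedDet S T M ≠ 0 ↔ S.card = T.card ∧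
      ∀ w : β → F, ∃ v : α → F, ∀ b ∈ T, ∑ a ∈ S, v a * M a b = w b := by
  by_cases h : S.card = T.card
  · rw [orderedDet_eq_det h, ← isUnit_iff_ne_zero, ← Matrix.isUnit_iff_isUnit_det,
      ← Matrix.vecMul_surjective_iff_isUnit]
    have hsum (v : α → F) (b : β) : ∑ a ∈ S, v a * M a b =
        ∑ s : T, v (colEquivRow h s) * M (colEquivRow h s) b := by
      rw [← Finset.sum_coe_sort S, ← (colEquivRow h).sum_comp]
    simp only [h, true_and, hsum]
    constructor
    · intro hs w
      obtain ⟨v, hv⟩ := hs fun b => w b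
      refine ⟨fun a => if ha : a ∈ S then v ((colEquivRow h).symm ⟨a, ha⟩) else 0, fun b hb => ?_⟩
      simpa [Matrix.vecMul, dotProduct] using congrFun hv ⟨b, hb⟩
    · intro hs w
      obtain ⟨v, hv⟩ := hs fun b => if hb : b ∈ T then w ⟨b, hb⟩ else 0
      refine ⟨fun s => v (colEquivRow h s), funext fun b => ?_⟩
      simpa [Matrix.vecMul, dotProduct] using hv b b.2
  · simp [orderedDet, h]

end OrderedDet

/-! ### The linear map of a system and its prolongations -/

section Prolongation

variable {σ ι κ K : Type*} [Field K]

/-- The derivatives `y_{s,k}` with `k < a_s`. -/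
def below (a : σ → ℕ) : Set (σ × ℕ) := {v | v.2 < a v.1}

theorem mem_supported_below {a : σ → ℕ} {c : σ × ℕ →₀ K} :
    c ∈ Finsupp.supported K K (below a) ↔ ∀ s l, a s ≤ l → c (s, l) = 0 := by
  simp [Finsupp.mem_supported', below]

theorem supported_below_mono {a b : σ → ℕ} (h : ∀ s, a s ≤ b s) :
    Finsupp.supported K K (below a) ≤ Finsupp.supported K K (below b) :=
  Finsupp.supported_mono fun v hv => lt_of_lt_of_le hv (h v.1)

/-- The pairs below `a` as a sum of initial segments. -/
def belowEquiv (a : σ → ℕ) : below a ≃ Σ s, Fin (a s) where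
  toFun v := ⟨v.1.1, v.1.2, v.2⟩
  invFun v := ⟨(v.1, v.2), v.2.2⟩
  left_inv _ := rfl
  right_inv _ := rfl

instance finite_supported_below [Finite σ] (a : σ → ℕ) :
    Module.Finite K (Finsupp.supported K K (below a)) :=
  have : Finite (below a) := .of_equiv _ (belowEquiv a).symm
  .equiv (Finsupp.supportedEquivFinsupp (M := K) (R := K) (below a)).symm

instance free_supported_below (a : σ → ℕ) :
    Module.Free K (Finsupp.supported K K (below a)) :=
  .of_equiv (Finsupp.supportedEquivFinsupp (M := K) (R := K) (below a)).symm

theorem finrank_supported_below [Fintype σ] (a : σ → ℕ) :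
    Module.finrank K (Finsupp.supported K K (below a)) = ∑ s, a s := by
  classical
  have : Fintype (below a) := .ofEquiv _ (belowEquiv a).symm
  rw [(Finsupp.supportedEquivFinsupp (M := K) (R := K) (below a)).finrank_eq,
    Module.finrank_finsupp_self, Fintype.card_congr (belowEquiv a)]
  simp

variable [Differential K]

theorem formDeriv_iterate_mem_supported_below {a : σ → ℕ} {c : σ × ℕ →₀ K}
    (hc : c ∈ Finsupp.supported K K (below a)) (q : ℕ) :
    formDeriv^[q] c ∈ Finsupp.supported K K (below fun s => a s + q) := by
  rw [mem_supported_below] at hc ⊢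
  intro s l hl
  exact formDeriv_iterate_apply_eq_zero c s 1 (a s) (fun l hl => hc s l (by omega)) q l (by omega)

/-- The `K`-linear map that substitutes the linear differential forms `h_i` for `x_i`, hence
`∂^k h_i` for `x_{i,k}`. -/
def prolong (h : ι → (κ × ℕ →₀ K)) : (ι × ℕ →₀ K) →ₗ[K] (κ × ℕ →₀ K) :=
  Finsupp.linearCombination K fun v => formDeriv^[v.2] (h v.1)

theorem prolong_single (h : ι → (κ × ℕ →₀ K)) (v : ι × ℕ) (a : K) :
    prolong h (Finsupp.single v a) = a • formDeriv^[v.2] (h v.1) := by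
  simp [prolong]

theorem prolong_formDeriv (h : ι → (κ × ℕ →₀ K)) (c : ι × ℕ →₀ K) :
    prolong h (formDeriv c) = formDeriv (prolong h c) := by
  induction c using Finsupp.induction_linear with
  | zero => simp
  | add c d hc hd => simp only [map_add, hc, hd]
  | single v a =>
    rw [formDeriv_single, map_add, prolong_single, prolong_single, prolong_single,
      formDeriv_smul, Function.iterate_succ_apply']

theorem prolong_formDeriv_iterate (h : ι → (κ × ℕ →₀ K)) (c : ι × ℕ →₀ K) (q : ℕ) :
    prolong h (formDeriv^[q] c) = formDeriv^[q] (prolong h c) := by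
  induction q with
  | zero => rfl
  | succ q ih =>
    rw [Function.iterate_succ_apply', prolong_formDeriv, ih, Function.iterate_succ_apply']

/-- If `h_i` has order at most `w_j - r_i` in `u_j`, then substitution takes the forms in the
`x_{i,k}`, `k < r_i + q`, to forms in the `u_{j,l}`, `l < w_j + q`. -/
theorem prolong_mem_supported_below {h : ι → (κ × ℕ →₀ K)} {r : ι → ℕ} {w : κ → ℕ}
    (hh : ∀ i j l, w j < l + r i → h i (j, l) = 0) (q : ℕ) :
    Finsupp.supported K K (below fun i => r i + q) ≤
      (Finsupp.supported K K (below fun j => w j + q)).comap (prolong h) := by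
  rw [Finsupp.supported_eq_span_single, Submodule.span_le]
  rintro _ ⟨⟨i, k⟩, hk, rfl⟩
  have hk : k < r i + q := hk
  simp only [Submodule.comap_coe, Set.mem_preimage, SetLike.mem_coe, prolong_single, one_smul]
  rw [mem_supported_below]
  intro j l hl
  exact formDeriv_iterate_apply_eq_zero _ j (r i) (w j) (hh i j) k l (by omega)

/-- Surjectivity persists when all bounds are raised by one: the new variable `u_{j,w_j}` is the
derivative of `u_{j,w_j-1}`. -/
theorem supported_below_le_map_prolong_succ {h : ι → (κ × ℕ →₀ K)} {r : ι → ℕ} {w : κ → ℕ}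
    (hw : ∀ j, 0 < w j)
    (hs : Finsupp.supported K K (below w) ≤ (Finsupp.supported K K (below r)).map (prolong h)) :
    Finsupp.supported K K (below fun j => w j + 1) ≤
      (Finsupp.supported K K (below fun i => r i + 1)).map (prolong h) := by
  have hs1 : Finsupp.supported K K (below w) ≤
      (Finsupp.supported K K (below fun i => r i + 1)).map (prolong h) :=
    hs.trans (Submodule.map_mono (supported_below_mono fun i => Nat.le_succ _))
  conv_lhs => rw [Finsupp.supported_eq_span_single]
  rw [Submodule.span_le]
  rintro _ ⟨⟨j, l⟩, hl, rfl⟩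
  have hl : l < w j + 1 := hl
  rcases Nat.lt_succ_iff_lt_or_eq.mp hl with hl | rfl
  · exact hs1 (Finsupp.single_mem_supported K _ hl)
  · obtain ⟨l, hl⟩ : ∃ l, w j = l + 1 := ⟨w j - 1, by have := hw j; omega⟩
    obtain ⟨c, hc, hcl⟩ := hs (Finsupp.single_mem_supported K (a := (j, l)) (1 : K)
      (show l < w j by omega))
    refine ⟨formDeriv c, formDeriv_iterate_mem_supported_below hc 1, ?_⟩
    rw [prolong_formDeriv, hcl, formDeriv_single, hl]
    simp

theorem supported_below_le_map_prolong_add {h : ι → (κ × ℕ →₀ K)} {r : ι → ℕ} {w : κ → ℕ}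
    (hw : ∀ j, 0 < w j)
    (hs : Finsupp.supported K K (below w) ≤ (Finsupp.supported K K (below r)).map (prolong h))
    (q : ℕ) :
    Finsupp.supported K K (below fun j => w j + q) ≤
      (Finsupp.supported K K (below fun i => r i + q)).map (prolong h) := by
  induction q with
  | zero => exact hs
  | succ q ih => exact supported_below_le_map_prolong_succ (fun j => Nat.add_pos_left (hw j) q) ih

/-- The derivatives of a syzygy `c` of order `k` in `x_i` realize all values of the coefficients of
`x_{i,k}, …, x_{i,k+p-1}` on the syzygies, by triangularity. -/
theorem exists_prolong_eq_zero_and_apply_eq {h : ι → (κ × ℕ →₀ K)} {r : ι → ℕ}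
    {c : ι × ℕ →₀ K} (hc : prolong h c = 0) (hcr : c ∈ Finsupp.supported K K (below r))
    {i : ι} {k : ℕ} (hk : c (i, k) ≠ 0) (hkl : ∀ l, k < l → c (i, l) = 0) (q p : ℕ)
    (hp : p ≤ q + 1) (z : ℕ → K) :
    ∃ x ∈ Finsupp.supported K K (below fun i => r i + q), prolong h x = 0 ∧
      (∀ l < p, x (i, k + l) = z l) ∧ ∀ l, p ≤ l → x (i, k + l) = 0 := by
  induction p generalizing z with
  | zero => exact ⟨0, Submodule.zero_mem _, map_zero _, by simp, by simp⟩
  | succ p ih =>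
    let d : ι × ℕ →₀ K := (z p / c (i, k)) • formDeriv^[p] c
    have hd0 (l : ℕ) (hl : p < l) : d (i, k + l) = 0 := by
      simp only [d, Finsupp.smul_apply]
      rw [formDeriv_iterate_apply_eq_zero c i 0 k hkl p _ (by omega), smul_zero]
    have hdp : d (i, k + p) = z p := by
      simp only [d, Finsupp.smul_apply, smul_eq_mul]
      rw [formDeriv_iterate_apply_top c i k hkl p, div_mul_cancel₀ _ hk]
    have hdr : d ∈ Finsupp.supported K K (below fun i => r i + q) :=
      Submodule.smul_mem _ _ (supported_below_mono (fun s => by omega)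
        (formDeriv_iterate_mem_supported_below hcr p))
    have hdk : prolong h d = 0 := by
      rw [map_smul, prolong_formDeriv_iterate, hc, iterate_map_zero, smul_zero]
    obtain ⟨x, hxr, hxk, hx1, hx2⟩ := ih (by omega) fun l => z l - d (i, k + l)
    refine ⟨x + d, Submodule.add_mem _ hxr hdr, by rw [map_add, hxk, hdk, add_zero], ?_, ?_⟩
    · intro l hl
      rcases Nat.lt_succ_iff_lt_or_eq.mp hl with hl | rfl
      · rw [Finsupp.add_apply, hx1 l hl, sub_add_cancel]
      · rw [Finsupp.add_apply, hx2 l le_rfl, hdp, zero_add]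
    · intro l hl
      rw [Finsupp.add_apply, hx2 l (by omega), hd0 l (by omega), add_zero]

/-- Let the substitution map the forms in the `x_{i,k}`, `k < r_i`, onto the forms in the
`u_{j,l}`, `l < w_j`, with one-dimensional kernel spanned by `c`, of order `k` in `x_i`. Then a
syzygy of arbitrary order that involves no `x_{i,l}`, `l ≥ k`, vanishes. After raising all bounds by
`q`, the kernel has dimension `q + 1`, and the coefficients of `x_{i,k}, …, x_{i,k+q}` map it onto
`K^{q+1}`, hence injectively. -/
theorem eq_zero_of_prolong_eq_zero [Fintype ι] [Fintype κ]
    (hcard : Fintype.card ι = Fintype.card κ + 1) {h : ι → (κ × ℕ →₀ K)} {r : ι → ℕ} {w : κ → ℕ}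
    (hh : ∀ i j l, w j < l + r i → h i (j, l) = 0) (hsum : ∑ i, r i = ∑ j, w j + 1)
    (hw : ∀ j, 0 < w j)
    (hs : Finsupp.supported K K (below w) ≤ (Finsupp.supported K K (below r)).map (prolong h))
    {c : ι × ℕ →₀ K} (hc : prolong h c = 0) (hcr : c ∈ Finsupp.supported K K (below r))
    {i : ι} {k : ℕ} (hk : c (i, k) ≠ 0) (hkl : ∀ l, k < l → c (i, l) = 0)
    {b : ι × ℕ →₀ K} (hb : prolong h b = 0) (hbi : ∀ l, k ≤ l → b (i, l) = 0) : b = 0 := by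
  obtain ⟨q, hq⟩ : ∃ q, b ∈ Finsupp.supported K K (below fun i => r i + q) := by
    refine ⟨b.support.sup Prod.snd + 1, mem_supported_below.mpr fun s l hl => ?_⟩
    by_contra hne
    have := Finset.le_sup (f := Prod.snd) (Finsupp.mem_support_iff.mpr hne)
    simp only at this
    omega
  let θ : (ι × ℕ →₀ K) →ₗ[K] (Fin (q + 1) → K) :=
    LinearMap.pi fun l => Finsupp.lapply (i, k + (l : ℕ))
  let F := ((prolong h).restrict
    fun _ hx => Submodule.mem_comap.mp (prolong_mem_supported_below hh q hx)).prod
    (θ ∘ₗ (Finsupp.supported K K (below fun i => r i + q)).subtype)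
  have hF : Function.Surjective F := by
    rintro ⟨⟨d, hd⟩, z⟩
    obtain ⟨v, hv, hvd⟩ := supported_below_le_map_prolong_add hw hs q hd
    obtain ⟨x, hx, hxk, hxz, -⟩ := exists_prolong_eq_zero_and_apply_eq hc hcr hk hkl q (q + 1)
      le_rfl fun l => if hl : l < q + 1 then z ⟨l, hl⟩ - v (i, k + l) else 0
    refine ⟨⟨v + x, Submodule.add_mem _ hv hx⟩, Prod.ext (Subtype.ext ?_) (funext fun l => ?_)⟩
    · change prolong h (v + x) = d
      rw [map_add, hvd, hxk, add_zero]
    · change (v + x) (i, k + (l : ℕ)) = z l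
      rw [Finsupp.add_apply, hxz l l.2, dif_pos l.2, add_sub_cancel]
  have hdim : Module.finrank K (Finsupp.supported K K (below fun i => r i + q)) =
      Module.finrank K (Finsupp.supported K K (below fun j => w j + q) × (Fin (q + 1) → K)) := by
    rw [Module.finrank_prod, finrank_supported_below, finrank_supported_below,
      Module.finrank_fin_fun, Finset.sum_add_distrib, Finset.sum_add_distrib, hsum]
    simp only [Finset.sum_const, Finset.card_univ, hcard, smul_eq_mul]
    ring
  have hinj : Function.Injective F := by
    let e := LinearEquiv.ofFinrankEq _ _ hdim
    have := OrzechProperty.injective_of_surjective_endomorphism (e.symm.toLinearMap ∘ₗ F)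
      (e.symm.surjective.comp hF)
    exact Function.Injective.of_comp this
  have : (⟨b, hq⟩ : Finsupp.supported K K (below fun i => r i + q)) = 0 := by
    apply hinj
    rw [map_zero]
    refine Prod.ext (Subtype.ext hb) (funext fun l => ?_)
    exact hbi _ (Nat.le_add_right _ _)
  exact congrArg Subtype.val this

end Prolongation

/-! ### Rows and columns of the resultant matrices -/

section Indices

variable {D : Type*} [CommRing D] {m : ℕ}

/-- The row of `∂^k f_i` as the pair `(i, k)`. -/
def rowIdx : Fin (m + 1) ×ₗ ℕᵒᵈ ≃ Fin (m + 1) × ℕ :=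
  ofLex.trans ((Equiv.refl _).prodCongr OrderDual.ofDual)

/-- The column of `u_{j,k}` as the pair `(j, k)`. -/
def colIdx : ℕᵒᵈ ×ₗ (Fin m)ᵒᵈ ≃ Fin m × ℕ :=
  ofLex.trans ((OrderDual.ofDual.prodCongr OrderDual.ofDual).trans (Equiv.prodComm _ _))

/-- The number of rows `∂^k f_i` for a given `i`. -/
def rowBound (f : Fin (m + 1) → DiffPoly (Fin m) D) (s : ℤ) (i : Fin (m + 1)) : ℕ :=
  (totalOrder f - order (f i) - gamma f - s + 1).toNat

/-- The number of columns `u_{j,k}` for a given `j`. -/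
def colBound (f : Fin (m + 1) → DiffPoly (Fin m) D) (s : ℤ) (j : Fin m) : ℕ :=
  (totalOrder f - gammaAt f j - gamma f - s + 1).toNat

variable (f : Fin (m + 1) → DiffPoly (Fin m) D) (s : ℤ)

theorem mem_rowSet (x : Fin (m + 1) ×ₗ ℕᵒᵈ) :
    x ∈ rowSet f s ↔ rowIdx x ∈ below (rowBound f s) := by
  simp only [rowSet, Finset.mem_biUnion, Finset.mem_univ, true_and, Finset.mem_image,
    Finset.mem_range]
  constructor
  · rintro ⟨i, k, hk, rfl⟩
    exact hk
  · intro h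
    exact ⟨(rowIdx x).1, (rowIdx x).2, h, rfl⟩

theorem mem_varSet (x : ℕᵒᵈ ×ₗ (Fin m)ᵒᵈ) :
    x ∈ varSet f s ↔ colIdx x ∈ below (colBound f s) := by
  simp only [varSet, Finset.mem_biUnion, Finset.mem_univ, true_and, Finset.mem_image,
    Finset.mem_range]
  constructor
  · rintro ⟨j, k, hk, rfl⟩
    exact hk
  · intro h
    exact ⟨(colIdx x).1, (colIdx x).2, h, rfl⟩

theorem card_rowSet : (rowSet f s).card = ∑ i, rowBound f s i := by
  rw [← Fintype.card_coe, ← Nat.card_eq_fintype_card,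
    Nat.card_congr ((rowIdx.subtypeEquiv (mem_rowSet f s)).trans
    (belowEquiv (rowBound f s)))]
  simp

theorem card_varSet : (varSet f s).card = ∑ j, colBound f s j := by
  rw [← Fintype.card_coe, ← Nat.card_eq_fintype_card,
    Nat.card_congr ((colIdx.subtypeEquiv (mem_varSet f s)).trans
    (belowEquiv (colBound f s)))]
  simp

theorem card_insert_top_varSet :
    (insert ⊤ ((varSet f s).image WithTop.some)).card = ∑ j, colBound f s j + 1 := by
  rw [Finset.card_insert_of_notMem (by simp),
    Finset.card_image_of_injective _ WithTop.coe_injective, card_varSet]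

/-- The defining inequality of `γ_j` for a variable `u_{j,l}` that occurs in `f_i`. -/
theorem add_gammaAt_le_order {i : Fin (m + 1)} {j : Fin m} {l : ℕ} (h : (j, l) ∈ (f i).vars) :
    (l : ℤ) + gammaAt f j ≤ order (f i) := by
  have h1 : gammaAt f j ≤ (order (f i) : ℤ) - ordIn (f i) j := Finset.inf'_le _ (Finset.mem_univ i)
  have h2 : (l : ℤ) ≤ ordIn (f i) j := by
    have := Finset.le_sup (s := (f i).vars.filter fun v => v.1 = j) (f := fun v => v.2 + 1)
      (b := (j, l)) (by simpa using h)
    simp only at this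
    rw [ordIn]
    omega
  omega

/-- If no column bound is truncated at `0`, and the numbers of rows and columns differ as they
should, then no row bound is truncated either. -/
theorem order_add_gamma_le (hcol : ∀ j, gammaAt f j + gamma f + s ≤ totalOrder f + 1)
    (hcard : (∑ i, rowBound f s i : ℕ) = (∑ j, colBound f s j : ℕ) + (1 - s)) (i : Fin (m + 1)) :
    (order (f i) : ℤ) + gamma f + s ≤ totalOrder f + 1 := by
  have hc (j : Fin m) : (colBound f s j : ℤ) = totalOrder f - gammaAt f j - gamma f - s + 1 :=
    Int.toNat_of_nonneg (by linarith [hcol j])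
  have hr (i : Fin (m + 1)) :
      totalOrder f - order (f i) - gamma f - s + 1 ≤ (rowBound f s i : ℤ) :=
    Int.self_le_toNat _
  have hsum : ∑ i, (totalOrder f - order (f i) - gamma f - s + 1) = ∑ i, (rowBound f s i : ℤ) := by
    push_cast at hcard
    rw [hcard, Finset.sum_congr rfl fun j _ => hc j]
    simp only [Finset.sum_add_distrib, Finset.sum_sub_distrib, Finset.sum_const, Finset.card_univ,
      Fintype.card_fin, nsmul_eq_mul]
    change _ - totalOrder f - _ - _ + _ = _ - gamma f - _ - _ + _ + _
    push_cast
    ring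
  have := (Finset.sum_eq_sum_iff_of_le fun i _ => hr i).mp hsum i (Finset.mem_univ i)
  have h0 : (0 : ℤ) ≤ rowBound f s i := Int.natCast_nonneg _
  linarith

end Indices

/-! ### Linear systems -/

section Systems

variable {K : Type*} [Field K] {m : ℕ}

theorem vars_C_add {τ R : Type*} [CommRing R] (a : R) (p : MvPolynomial τ R) :
    (C a + p).vars = p.vars := by
  classical
  ext v
  simp only [mem_vars_iff_mem_support, mem_support_iff, coeff_add, coeff_C]
  refine exists_congr fun d => and_congr_left fun hd => ?_
  rw [if_neg (by rintro rfl; simp at hd), zero_add]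

theorem exists_homPart_eq_linForm (P : Fin (m + 1) → DiffPoly (Fin m) K)
    (hP : ∀ i, (P i).totalDegree ≤ 1) :
    ∃ h : Fin (m + 1) → (Fin m × ℕ →₀ K), ∀ i, homPart P i = linForm (h i) := by
  choose c hc using fun i => exists_eq_C_add_linForm (P i) (hP i)
  refine ⟨fun i => -c i, fun i => ?_⟩
  rw [homPart, map_neg, sub_eq_iff_eq_add]
  nth_rewrite 2 [hc i]
  ring

variable (P : Fin (m + 1) → DiffPoly (Fin m) K)

theorem vars_eqPoly (i : Fin (m + 1)) : (eqPoly P i).vars = (homPart P i).vars := by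
  rw [eqPoly, vars_C_add, vars_map_of_injective _ (C_injective _ _)]

theorem order_eqPoly (i : Fin (m + 1)) : order (eqPoly P i) = order (homPart P i) := by
  rw [order, order, vars_eqPoly]

theorem totalOrder_eqPoly : totalOrder (eqPoly P) = totalOrder (homPart P) := by
  simp only [totalOrder, order_eqPoly]

theorem gammaAt_eqPoly (j : Fin m) : gammaAt (eqPoly P) j = gammaAt (homPart P) j := by
  simp only [gammaAt, order_eqPoly, ordIn, vars_eqPoly]

theorem gamma_eqPoly : gamma (eqPoly P) = gamma (homPart P) := by
  simp only [gamma, gammaAt_eqPoly]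

theorem rowSet_eqPoly (s : ℤ) : rowSet (eqPoly P) s = rowSet (homPart P) s := by
  simp only [rowSet, totalOrder_eqPoly, order_eqPoly, gamma_eqPoly]

theorem varSet_eqPoly (s : ℤ) : varSet (eqPoly P) s = varSet (homPart P) s := by
  simp only [varSet, totalOrder_eqPoly, gammaAt_eqPoly, gamma_eqPoly]

variable {P} {h : Fin (m + 1) → (Fin m × ℕ →₀ K)}

/-- The order bounds of a system fit the bounds on the rows and columns of its resultant matrix,
unless a row bound is truncated at `0`. -/
theorem apply_eq_zero_of_colBound_lt (hh : ∀ i, homPart P i = linForm (h i)) {s : ℤ}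
    (hr : ∀ i, (order (homPart P i) : ℤ) + gamma (homPart P) + s ≤ totalOrder (homPart P) + 1)
    (i : Fin (m + 1)) (j : Fin m) (l : ℕ)
    (hl : colBound (homPart P) s j < l + rowBound (homPart P) s i) : h i (j, l) = 0 := by
  by_contra hne
  have hv : (j, l) ∈ (homPart P i).vars := by
    simpa [hh i] using mem_vars_C_add_linForm 0 (h i) (j, l) hne
  have h1 := add_gammaAt_le_order (homPart P) hv
  have h2 := hr i
  simp only [colBound, rowBound] at hl
  omega

/-- The vector in the rows of a resultant matrix as an element of the `K`-span of the `x_{i,k}`. -/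
def rowVec (S : Finset (Fin (m + 1) ×ₗ ℕᵒᵈ)) (v : Fin (m + 1) ×ₗ ℕᵒᵈ → K) :
    Fin (m + 1) × ℕ →₀ K :=
  ∑ a ∈ S, Finsupp.single (rowIdx a) (v a)

theorem rowVec_apply {S : Finset (Fin (m + 1) ×ₗ ℕᵒᵈ)} (v : Fin (m + 1) ×ₗ ℕᵒᵈ → K)
    {a : Fin (m + 1) ×ₗ ℕᵒᵈ} (ha : a ∈ S) : rowVec S v (rowIdx a) = v a := by
  classical
  simp [rowVec, Finsupp.finsetSum_apply, Finsupp.single_apply, ha]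

theorem rowVec_mem {f : Fin (m + 1) → DiffPoly (Fin m) K} {s : ℤ} (v : Fin (m + 1) ×ₗ ℕᵒᵈ → K) :
    rowVec (rowSet f s) v ∈ Finsupp.supported K K (below (rowBound f s)) :=
  Submodule.sum_mem _ fun a ha => Finsupp.single_mem_supported K _ ((mem_rowSet f s a).mp ha)

theorem rowVec_apply_rowIdx {f : Fin (m + 1) → DiffPoly (Fin m) K} {s : ℤ}
    {c : Fin (m + 1) × ℕ →₀ K} (hc : c ∈ Finsupp.supported K K (below (rowBound f s))) :
    rowVec (rowSet f s) (fun a => c (rowIdx a)) = c := by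
  ext v
  obtain ⟨a, rfl⟩ := rowIdx.surjective v
  by_cases ha : a ∈ rowSet f s
  · rw [rowVec_apply _ ha]
  · rw [(Finsupp.mem_supported' K _).mp (rowVec_mem _) _ ((mem_rowSet f s a).not.mp ha),
      (Finsupp.mem_supported' K _).mp hc _ ((mem_rowSet f s a).not.mp ha)]

variable [Differential K]

theorem rowPoly_homPart (hh : ∀ i, homPart P i = linForm (h i)) (a : Fin (m + 1) ×ₗ ℕᵒᵈ) :
    rowPoly (homPart P) a = linForm (formDeriv^[(rowIdx a).2] (h (rowIdx a).1)) := by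
  have := deriv_iterate_C_add_linForm 0 (h (rowIdx a).1) (rowIdx a).2
  rw [← deriv_iterate_C, map_zero, zero_add, iterate_map_zero, zero_add, ← hh] at this
  exact this

theorem varCoeff_rowPoly_homPart (hh : ∀ i, homPart P i = linForm (h i))
    (a : Fin (m + 1) ×ₗ ℕᵒᵈ) (b : ℕᵒᵈ ×ₗ (Fin m)ᵒᵈ) :
    varCoeff (rowPoly (homPart P) a) b =
      formDeriv^[(rowIdx a).2] (h (rowIdx a).1) (colIdx b) := by
  rw [rowPoly_homPart hh]
  exact coeff_linForm _ _

variable (P) in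
/-- The constant term `∂^k a_i` of `∂^k P_i`. -/
def constTerm (v : Fin (m + 1) × ℕ) : K := (fun x : K => x′)^[v.2] (constantCoeff (P v.1))

theorem rowPoly_eqPoly (hh : ∀ i, homPart P i = linForm (h i)) (a : Fin (m + 1) ×ₗ ℕᵒᵈ) :
    rowPoly (eqPoly P) a = C (X (rowIdx a) - C (constTerm P (rowIdx a))) +
      linForm ((formDeriv^[(rowIdx a).2] (h (rowIdx a).1)).mapRange C (map_zero C)) := by
  have h1 : eqPoly P (rowIdx a).1 = C (X ((rowIdx a).1, 0) -
      C (constantCoeff (P (rowIdx a).1))) + linForm ((h (rowIdx a).1).mapRange C (map_zero C)) := by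
    rw [eqPoly, hh, map_linForm]
  change (fun p : DiffPoly (Fin m) (DiffPoly (Fin (m + 1)) K) => p′)^[(rowIdx a).2]
    (eqPoly P (rowIdx a).1) = _
  rw [h1, deriv_iterate_C_add_linForm, formDeriv_iterate_mapRange C fun a => (deriv_C a).symm]
  congr 2
  have hsub (p q : DiffPoly (Fin (m + 1)) K) (k : ℕ) : (fun p : DiffPoly (Fin (m + 1)) K => p′)^[k]
      (p - q) = (fun p : DiffPoly (Fin (m + 1)) K => p′)^[k] p -
        (fun p : DiffPoly (Fin (m + 1)) K => p′)^[k] q :=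
    iterate_map_sub (Differential.deriv (R := DiffPoly (Fin (m + 1)) K)) k p q
  rw [hsub, deriv_iterate_X, deriv_iterate_C]
  rfl

theorem colCoeff_rowPoly_eqPoly (hh : ∀ i, homPart P i = linForm (h i))
    (a : Fin (m + 1) ×ₗ ℕᵒᵈ) :
    colCoeff (rowPoly (eqPoly P) a) =
      Function.update (fun b => C (colCoeff (rowPoly (homPart P) a) b)) ⊤
        (X (rowIdx a) - C (constTerm P (rowIdx a))) := by
  funext b
  rw [rowPoly_eqPoly hh, rowPoly_homPart hh]
  induction b using WithTop.recTopCoe with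
  | top => simp [colCoeff]
  | coe b =>
    rw [Function.update_of_ne (by simp)]
    simp only [colCoeff, varCoeff, coeff_add, coeff_linForm, Finsupp.mapRange_apply]
    rw [coeff_C, if_neg (Finsupp.single_ne_zero.mpr one_ne_zero).symm, zero_add]

theorem prolong_rowVec_apply (hh : ∀ i, homPart P i = linForm (h i))
    (S : Finset (Fin (m + 1) ×ₗ ℕᵒᵈ)) (v : Fin (m + 1) ×ₗ ℕᵒᵈ → K) (b : ℕᵒᵈ ×ₗ (Fin m)ᵒᵈ) :
    prolong h (rowVec S v) (colIdx b) = ∑ a ∈ S, v a * varCoeff (rowPoly (homPart P) a) b := by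
  simp only [rowVec, map_sum, prolong_single, Finsupp.finsetSum_apply, Finsupp.smul_apply,
    smul_eq_mul, varCoeff_rowPoly_homPart hh]

/-- Full rank of the matrix in the `u_{j,k}` means surjectivity of the substitution. -/
theorem supported_below_le_map_prolong (hh : ∀ i, homPart P i = linForm (h i)) {s : ℤ}
    (hr : ∀ i, (order (homPart P i) : ℤ) + gamma (homPart P) + s ≤ totalOrder (homPart P) + 1)
    (hs : ∀ w : ℕᵒᵈ ×ₗ (Fin m)ᵒᵈ → K, ∃ v : Fin (m + 1) ×ₗ ℕᵒᵈ → K,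
      ∀ b ∈ varSet (homPart P) s,
        ∑ a ∈ rowSet (homPart P) s, v a * varCoeff (rowPoly (homPart P) a) b = w b) :
    Finsupp.supported K K (below (colBound (homPart P) s)) ≤
      (Finsupp.supported K K (below (rowBound (homPart P) s))).map (prolong h) := by
  intro d hd
  obtain ⟨v, hv⟩ := hs fun b => d (colIdx b)
  refine ⟨_, rowVec_mem (s := s) v, Finsupp.ext fun x => ?_⟩
  obtain ⟨b, rfl⟩ := colIdx.surjective x
  by_cases hb : b ∈ varSet (homPart P) s
  · rw [prolong_rowVec_apply hh, hv b hb]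
  · have hm := prolong_mem_supported_below (apply_eq_zero_of_colBound_lt hh hr) 0
      (rowVec_mem (s := s) v)
    rw [(Finsupp.mem_supported' K _).mp hm _ ((mem_varSet _ s b).not.mp hb),
      (Finsupp.mem_supported' K _).mp hd _ ((mem_varSet _ s b).not.mp hb)]

/-! ### The resultant as a syzygy -/

variable (P) in
/-- The cofactors of the last column of the matrix of `∂CRes(F_1, …, F_n)`. They do not involve the
`x_{i,k}`. -/
def cofactor (a : Fin (m + 1) ×ₗ ℕᵒᵈ) : K :=
  orderedDet (rowSet (homPart P) 0) (insert ⊤ ((varSet (homPart P) 0).image WithTop.some))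
    fun a' => Function.update (colCoeff (rowPoly (homPart P) a')) ⊤ ((Pi.single a 1 :
      Fin (m + 1) ×ₗ ℕᵒᵈ → K) a')

variable (P) in
/-- The linear part of `∂CRes(F_1, …, F_n)`. -/
def resVec : Fin (m + 1) × ℕ →₀ K := rowVec (rowSet (homPart P) 0) (cofactor P)

theorem cres_eqPoly_eq_sum (hh : ∀ i, homPart P i = linForm (h i)) :
    cres (eqPoly P) = ∑ a ∈ rowSet (homPart P) 0,
      (X (rowIdx a) - C (constTerm P (rowIdx a))) * C (cofactor P a) := by
  simp only [cres, colCoeff_rowPoly_eqPoly hh, rowSet_eqPoly, varSet_eqPoly]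
  rw [orderedDet_update_col (Finset.mem_insert_self _ _)]
  refine Finset.sum_congr rfl fun a _ => ?_
  congr 1
  rw [cofactor, ← orderedDet_map]
  congr 1
  funext a' b
  by_cases hb : b = ⊤
  · subst hb
    by_cases ha : a' = a
    · subst ha
      simp
    · simp [ha]
  · simp [hb]

theorem cres_eqPoly_eq (hh : ∀ i, homPart P i = linForm (h i)) :
    cres (eqPoly P) =
      C (-Finsupp.linearCombination K (constTerm P) (resVec P)) + linForm (resVec P) := by
  rw [cres_eqPoly_eq_sum hh, resVec, rowVec, map_sum, map_sum, ← Finset.sum_neg_distrib, map_sum,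
    ← Finset.sum_add_distrib]
  refine Finset.sum_congr rfl fun a _ => ?_
  rw [linForm_single, Finsupp.linearCombination_single, smul_eq_mul, map_neg, map_mul]
  ring

theorem prolong_resVec (hh : ∀ i, homPart P i = linForm (h i))
    (hr : ∀ i, (order (homPart P i) : ℤ) + gamma (homPart P) + 0 ≤ totalOrder (homPart P) + 1) :
    prolong h (resVec P) = 0 := by
  ext x
  obtain ⟨b, rfl⟩ := colIdx.surjective x
  by_cases hb : b ∈ varSet (homPart P) 0
  · rw [resVec, prolong_rowVec_apply hh, Finsupp.zero_apply]
    -- the expansion of the determinant in which the last column is replaced by the column `b`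
    rw [← orderedDet_eq_zero_of_col_eq
      (S := rowSet (homPart P) 0) (T := insert ⊤ ((varSet (homPart P) 0).image WithTop.some))
      (Finset.mem_insert_self _ _) (t' := (b : WithTop _))
      (Finset.mem_insert_of_mem (Finset.mem_image_of_mem _ hb)) (WithTop.coe_ne_top).symm
      (fun a => Function.update (colCoeff (rowPoly (homPart P) a)) ⊤
        (varCoeff (rowPoly (homPart P) a) b)) fun a => by simp [colCoeff],
      orderedDet_update_col (Finset.mem_insert_self _ _)]
    exact Finset.sum_congr rfl fun a _ => mul_comm _ _
  · have hm := prolong_mem_supported_below (apply_eq_zero_of_colBound_lt hh hr) 0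
      (rowVec_mem (s := 0) (cofactor P))
    exact (Finsupp.mem_supported' K _).mp hm _ ((mem_varSet _ 0 b).not.mp hb)

theorem resVec_apply_rowIdx {a : Fin (m + 1) ×ₗ ℕᵒᵈ} (ha : a ∈ rowSet (homPart P) 0) :
    resVec P (rowIdx a) = cofactor P a :=
  rowVec_apply _ ha

/-- If the resultant does not vanish, then the matrix is square and its columns of the `u_{j,k}`
have full rank. -/
theorem full_rank_of_cres_ne_zero (hh : ∀ i, homPart P i = linForm (h i))
    (hne : cres (eqPoly P) ≠ 0) :
    resVec P ≠ 0 ∧ ∑ i, rowBound (homPart P) 0 i = ∑ j, colBound (homPart P) 0 j + 1 ∧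
      ∀ w : ℕᵒᵈ ×ₗ (Fin m)ᵒᵈ → K, ∃ v : Fin (m + 1) ×ₗ ℕᵒᵈ → K,
        ∀ b ∈ varSet (homPart P) 0,
          ∑ a ∈ rowSet (homPart P) 0, v a * varCoeff (rowPoly (homPart P) a) b = w b := by
  obtain ⟨a, ha, hca⟩ : ∃ a ∈ rowSet (homPart P) 0, cofactor P a ≠ 0 := by
    by_contra! hc
    refine hne ?_
    rw [cres_eqPoly_eq_sum hh]
    exact Finset.sum_eq_zero fun a ha => by rw [hc a ha, map_zero, mul_zero]
  refine ⟨fun h0 => hca ?_, ?_⟩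
  · rw [← resVec_apply_rowIdx ha, h0, Finsupp.zero_apply]
  obtain ⟨hcard, hs⟩ := (orderedDet_ne_zero_iff _).mp hca
  rw [card_rowSet, card_insert_top_varSet] at hcard
  refine ⟨hcard, fun w => ?_⟩
  obtain ⟨v, hv⟩ := hs (WithTop.recTopCoe 0 w)
  refine ⟨v, fun b hb => ?_⟩
  have := hv b (Finset.mem_insert_of_mem (Finset.mem_image_of_mem _ hb))
  simpa [colCoeff] using this

/-- Conversely, if the substitution is onto the forms in the column variables, and there is one row
more than there are such variables, then the resultant does not vanish: the substitution has a
syzygy, and the cofactor of a row in which the syzygy is nonzero does not vanish. -/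
theorem cres_ne_zero (hh : ∀ i, homPart P i = linForm (h i))
    (hr : ∀ i, (order (homPart P i) : ℤ) + gamma (homPart P) + 0 ≤ totalOrder (homPart P) + 1)
    (hsum : ∑ i, rowBound (homPart P) 0 i = ∑ j, colBound (homPart P) 0 j + 1)
    (hs : Finsupp.supported K K (below (colBound (homPart P) 0)) ≤
      (Finsupp.supported K K (below (rowBound (homPart P) 0))).map (prolong h)) :
    cres (eqPoly P) ≠ 0 := by
  obtain ⟨x, hx, hx0, hxk⟩ : ∃ x ∈ Finsupp.supported K K (below (rowBound (homPart P) 0)),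
      x ≠ 0 ∧ prolong h x = 0 := by
    by_contra! hc
    have hinj : Function.Injective ((prolong h).restrict fun _ hx => Submodule.mem_comap.mp
        (prolong_mem_supported_below (apply_eq_zero_of_colBound_lt hh hr) 0 hx)) := by
      rintro ⟨x, hx⟩ ⟨y, hy⟩ hxy
      by_contra hne
      refine hc (x - y) (Submodule.sub_mem _ hx hy)
        (sub_ne_zero.mpr fun e => hne (Subtype.ext e)) ?_
      rw [map_sub, sub_eq_zero]
      exact congrArg Subtype.val hxy
    have := LinearMap.finrank_le_finrank_of_injective hinj
    rw [finrank_supported_below, finrank_supported_below] at this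
    simp only [add_zero] at this
    omega
  obtain ⟨y, hy⟩ := Finsupp.ne_iff.mp hx0
  obtain ⟨a, rfl⟩ := rowIdx.surjective y
  rw [Finsupp.zero_apply] at hy
  have ha : a ∈ rowSet (homPart P) 0 := by
    rw [mem_rowSet]
    by_contra h
    exact hy ((Finsupp.mem_supported' K _).mp hx _ h)
  have hca : cofactor P a ≠ 0 := by
    refine (orderedDet_ne_zero_iff _).mpr ⟨by rw [card_rowSet, card_insert_top_varSet, hsum], ?_⟩
    intro w
    let d : Fin m × ℕ →₀ K := ∑ b ∈ varSet (homPart P) 0, Finsupp.single (colIdx b) (w b)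
    have hd : d ∈ Finsupp.supported K K (below (colBound (homPart P) 0)) :=
      Submodule.sum_mem _ fun b hb => Finsupp.single_mem_supported K _ ((mem_varSet _ 0 b).mp hb)
    obtain ⟨c, hc, hcd⟩ := hs hd
    -- adding a multiple of the syzygy adjusts the last column
    let t : K := (w ⊤ - c (rowIdx a)) / x (rowIdx a)
    refine ⟨fun a' => (c + t • x) (rowIdx a'), fun b hb => ?_⟩
    induction b using WithTop.recTopCoe with
    | top =>
      simp only [Function.update_self, Pi.single_apply, mul_ite, mul_one, mul_zero]
      rw [Finset.sum_ite_eq' , if_pos ha, Finsupp.add_apply, Finsupp.smul_apply, smul_eq_mul,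
        div_mul_cancel₀ _ hy, add_sub_cancel]
    | coe b =>
      have hb : b ∈ varSet (homPart P) 0 := by simpa using hb
      have hne : ((b : ℕᵒᵈ ×ₗ (Fin m)ᵒᵈ) : WithTop (ℕᵒᵈ ×ₗ (Fin m)ᵒᵈ)) ≠ ⊤ := WithTop.coe_ne_top
      simp only [Function.update_of_ne hne, colCoeff]
      rw [← prolong_rowVec_apply hh,
        rowVec_apply_rowIdx (Submodule.add_mem _ hc (Submodule.smul_mem _ t hx)), map_add, map_smul,
        hxk, smul_zero, add_zero, hcd]
      classical
      simp [d, Finsupp.finsetSum_apply, Finsupp.single_apply, hb]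
  intro h0
  have := congrArg (coeff (Finsupp.single (rowIdx a) 1)) h0
  rw [cres_eqPoly_eq hh, coeff_add, coeff_C, if_neg (Finsupp.single_ne_zero.mpr one_ne_zero).symm,
    zero_add, coeff_linForm, resVec_apply_rowIdx ha, coeff_zero] at this
  exact hca this

end Systems

/-! ### Linear polynomials over a field -/

section Linear

variable {τ K : Type*} [Field K]

theorem totalDegree_C_add_linForm_le (a : K) (c : τ →₀ K) :
    (C a + linForm c).totalDegree ≤ 1 :=
  (totalDegree_add _ _).trans (max_le (by simp) (totalDegree_linForm_le c))

theorem vars_C_add_linForm (a : K) (c : τ →₀ K) : (C a + linForm c).vars = c.support := by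
  classical
  refine Finset.Subset.antisymm ?_ fun v hv =>
    mem_vars_C_add_linForm a c v (Finsupp.mem_support_iff.mp hv)
  rw [vars_C_add, linForm, Finsupp.linearCombination_apply, Finsupp.sum]
  refine (vars_sum_subset _ _).trans (Finset.biUnion_subset.mpr fun v hv => ?_)
  rw [MvPolynomial.smul_eq_C_mul]
  refine (vars_mul _ _).trans ?_
  rw [vars_C, vars_X, Finset.empty_union]
  simpa using hv

theorem irreducible_C_add_linForm (a : K) {c : τ →₀ K} (hc : c ≠ 0) :
    Irreducible (C a + linForm c) := by
  obtain ⟨v, hv⟩ := Finsupp.ne_iff.mp hc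
  rw [Finsupp.zero_apply] at hv
  have hcoeff : coeff (Finsupp.single v 1) (C a + linForm c) = c v := by
    classical
    rw [coeff_add, coeff_C, if_neg (Finsupp.single_ne_zero.mpr one_ne_zero).symm, zero_add,
      coeff_linForm]
  refine irreducible_of_totalDegree_eq_one
    ((totalDegree_C_add_linForm_le a c).antisymm ?_) fun x hx => ?_
  · have := le_totalDegree (mem_support_iff.mpr (hcoeff.trans_ne hv))
    simpa using this
  · have := hx (Finsupp.single v 1)
    rw [hcoeff] at this
    exact isUnit_iff_ne_zero.mpr (ne_zero_of_dvd_ne_zero hv this)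

end Linear

/-! ### The implicit ideal -/

section Implicit

theorem Ranking.lt_add {σ : Type*} (rk : Ranking σ) (v : σ × ℕ) (l : ℕ) :
    rk.lt v (v.1, v.2 + l + 1) := by
  induction l with
  | zero => exact rk.lt_deriv v
  | succ l ih => exact rk.trans _ _ _ ih (rk.lt_deriv _)

variable {K : Type*} [Field K] [Differential K] {m : ℕ} {P : Fin (m + 1) → DiffPoly (Fin m) K}
  {h : Fin (m + 1) → (Fin m × ℕ →₀ K)}

theorem deriv_iterate_eq (hh : ∀ i, homPart P i = linForm (h i)) (v : Fin (m + 1) × ℕ) :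
    (fun p : DiffPoly (Fin m) K => p′)^[v.2] (P v.1) =
      C (constTerm P v) - linForm (formDeriv^[v.2] (h v.1)) := by
  have h1 : P v.1 = C (constantCoeff (P v.1)) + linForm (-h v.1) := by
    rw [map_neg, ← hh, homPart]
    ring
  rw [h1, deriv_iterate_C_add_linForm, iterate_map_neg, map_neg, ← sub_eq_add_neg]
  rfl

theorem mem_implicitIdeal_iff (hh : ∀ i, homPart P i = linForm (h i))
    (f : DiffPoly (Fin (m + 1)) K) :
    f ∈ implicitIdeal P ↔
      aeval (fun v : Fin (m + 1) × ℕ =>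
        (C (constTerm P v) - linForm (formDeriv^[v.2] (h v.1)) : DiffPoly (Fin m) K)) f = 0 := by
  simp only [implicitIdeal, deriv_iterate_eq hh]
  rfl

/-- A syzygy of the linear forms `h_i` gives a linear differential polynomial in the implicit
ideal. -/
theorem C_add_linForm_mem_implicitIdeal (hh : ∀ i, homPart P i = linForm (h i))
    {c : Fin (m + 1) × ℕ →₀ K} (hc : prolong h c = 0) :
    C (-Finsupp.linearCombination K (constTerm P) c) + linForm c ∈ implicitIdeal P := by
  have key (c : Fin (m + 1) × ℕ →₀ K) :
      aeval (fun v : Fin (m + 1) × ℕ =>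
        (C (constTerm P v) - linForm (formDeriv^[v.2] (h v.1)) : DiffPoly (Fin m) K)) (linForm c) =
      C (Finsupp.linearCombination K (constTerm P) c) - linForm (prolong h c) := by
    induction c using Finsupp.induction_linear with
    | zero => simp
    | add c d hc hd => simp only [map_add, hc, hd]; ring
    | single v a =>
      simp only [linForm_single, prolong_single, Finsupp.linearCombination_single, map_mul, aeval_X,
        aeval_C, algebraMap_eq, LinearMap.map_smul, smul_eq_mul, MvPolynomial.smul_eq_C_mul]
      ring
  rw [mem_implicitIdeal_iff hh, map_add, key, hc, map_zero, sub_zero, map_neg, map_neg,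
    aeval_C, algebraMap_eq, neg_add_cancel]

/-- If no nontrivial syzygy is supported in `T`, then no nonzero element of the implicit ideal
involves only the variables in `T`: a left inverse of the substitution on the forms in these
variables gives a homomorphism `K{U} → K{X}` that recovers them up to sign and constants. -/
theorem eq_zero_of_mem_implicitIdeal (hh : ∀ i, homPart P i = linForm (h i))
    {T : Set (Fin (m + 1) × ℕ)}
    (hT : ∀ b ∈ Finsupp.supported K K T, prolong h b = 0 → b = 0)
    {f : DiffPoly (Fin (m + 1)) K} (hf : f ∈ implicitIdeal P) (hfT : ∀ v ∈ f.vars, v ∈ T) :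
    f = 0 := by
  obtain ⟨g, hg⟩ : ∃ g : (Fin m × ℕ →₀ K) →ₗ[K] (Fin (m + 1) × ℕ →₀ K),
      ∀ v ∈ T, g (prolong h (Finsupp.single v 1)) = Finsupp.single v 1 := by
    let e : (T →₀ K) →ₗ[K] (Fin (m + 1) × ℕ →₀ K) := Finsupp.lmapDomain K K Subtype.val
    obtain ⟨g, hg⟩ := (prolong h ∘ₗ e).exists_leftInverse_of_injective <| by
      rw [LinearMap.ker_eq_bot']
      intro b hb
      refine Finsupp.mapDomain_injective Subtype.val_injective
        ((hT _ ?_ hb).trans Finsupp.mapDomain_zero.symm)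
      refine (Finsupp.mem_supported' K _).mpr fun v hv => Finsupp.mapDomain_of_notMem_range _ _ ?_
      simpa using hv
    refine ⟨e ∘ₗ g, fun v hv => ?_⟩
    have h1 : e (Finsupp.single ⟨v, hv⟩ 1) = Finsupp.single v 1 := by simp [e]
    have h2 := LinearMap.congr_fun hg (Finsupp.single ⟨v, hv⟩ 1)
    rw [LinearMap.comp_apply, LinearMap.comp_apply, h1, LinearMap.id_apply] at h2
    rw [LinearMap.comp_apply, h2, h1]
  let Ψ : DiffPoly (Fin m) K →ₐ[K] DiffPoly (Fin (m + 1)) K :=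
    aeval fun u => linForm (g (Finsupp.single u 1))
  have hΨ (w : Fin m × ℕ →₀ K) : Ψ (linForm w) = linForm (g w) := by
    induction w using Finsupp.induction_linear with
    | zero => simp
    | add c d hc hd => simp only [map_add, hc, hd]
    | single u a =>
      rw [linForm_single, map_mul, aeval_X, ← algebraMap_eq, AlgHom.commutes, ← Algebra.smul_def,
        ← map_smul, ← map_smul, Finsupp.smul_single, smul_eq_mul, mul_one]
  -- the involution `x ↦ a - x`
  let ρ : DiffPoly (Fin (m + 1)) K →ₐ[K] DiffPoly (Fin (m + 1)) K :=
    aeval fun v => C (constTerm P v) - X v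
  have hρ : ρ f = 0 := by
    rw [mem_implicitIdeal_iff hh] at hf
    have h0 := congrArg Ψ hf
    rw [map_zero, ← AlgHom.comp_apply] at h0
    rw [← h0]
    refine hom_congr_vars (f₁ := ρ.toRingHom) (f₂ := (Ψ.comp (aeval _)).toRingHom) ?_
      (fun v hv _ => ?_) rfl
    · ext a
      simp [← algebraMap_eq]
    · have hb := hg v (hfT v hv)
      rw [prolong_single, one_smul] at hb
      change ρ (X v) = Ψ (aeval _ (X v))
      rw [aeval_X, aeval_X, map_sub, hΨ, hb, linForm_single, C_1, one_mul, aeval_C,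
        algebraMap_eq]
  have hinv : ρ.comp ρ = AlgHom.id K _ := by
    ext1 v
    simp [ρ, ← algebraMap_eq]
  rw [← AlgHom.id_apply (R := K) f, ← hinv, AlgHom.comp_apply, hρ, map_zero]

/-- Let `A` be the linear polynomial of a nonzero syzygy `c` such that, for every `i`, a syzygy of
lower order in `x_i` vanishes. Then `A` is an implicit equation. -/
theorem isImplicitEquation_of_prolong_eq_zero (hh : ∀ i, homPart P i = linForm (h i))
    {c : Fin (m + 1) × ℕ →₀ K} (hc : prolong h c = 0) (hc0 : c ≠ 0)
    (hmin : ∀ i k, c (i, k) ≠ 0 → (∀ l, k < l → c (i, l) = 0) →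
      ∀ b, prolong h b = 0 → (∀ l, k ≤ l → b (i, l) = 0) → b = 0) :
    IsImplicitEquation P (C (-Finsupp.linearCombination K (constTerm P) c) + linForm c) := by
  set A : DiffPoly (Fin (m + 1)) K :=
    C (-Finsupp.linearCombination K (constTerm P) c) + linForm c
  have hvars : A.vars = c.support := vars_C_add_linForm _ _
  have hmem : A ∈ implicitIdeal P := C_add_linForm_mem_implicitIdeal hh hc
  have hirr : Irreducible A := irreducible_C_add_linForm _ hc0
  have key (i : Fin (m + 1)) (k : ℕ) (hk : c (i, k) ≠ 0) (hkl : ∀ l, k < l → c (i, l) = 0)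
      (f : DiffPoly (Fin (m + 1)) K) (hf : f ∈ implicitIdeal P)
      (hfv : ∀ l, (i, k + l) ∉ f.vars) : f = 0 := by
    refine eq_zero_of_mem_implicitIdeal hh (T := {v | ∀ l, v ≠ (i, k + l)}) (fun b hb hb0 => ?_)
      hf fun v hv l => by rintro rfl; exact hfv l hv
    refine hmin i k hk hkl b hb0 fun l hl => ?_
    obtain ⟨l, rfl⟩ := Nat.exists_eq_add_of_le hl
    exact (Finsupp.mem_supported' K _).mp hb _ fun h => h l rfl
  classical
  refine ⟨le_antisymm ?_ ?_, fun rk => ⟨hirr, ⟨⟨?_, ?_⟩, ?_⟩, ?_⟩⟩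
  · rw [diffDim]
    refine Finset.sup_le fun Y hY => ?_
    by_contra hlt
    have hYu : Y = Finset.univ := by
      rw [← Finset.card_eq_iff_eq_univ, Fintype.card_fin]
      have := Finset.card_le_univ Y
      rw [Fintype.card_fin] at this
      omega
    exact hirr.ne_zero ((Finset.mem_filter.mp hY).2 A hmem fun v _ => hYu ▸ Finset.mem_univ _)
  · -- all indeterminates but one that occurs in `A` are independent
    obtain ⟨⟨i, k₀⟩, hik⟩ := Finsupp.ne_iff.mp hc0
    have hex : ∃ k, c (i, k) ≠ 0 ∧ ∀ l, k < l → c (i, l) = 0 := by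
      obtain ⟨v, hv, hmax⟩ := Finset.exists_max_image (c.support.filter fun v => v.1 = i) Prod.snd
        ⟨(i, k₀), by simpa using hik⟩
      obtain ⟨hvc, rfl⟩ := Finset.mem_filter.mp hv
      refine ⟨v.2, Finsupp.mem_support_iff.mp hvc, fun l hl => ?_⟩
      by_contra hne
      exact absurd (hmax (v.1, l) (by simpa using hne)) (not_le.mpr hl)
    obtain ⟨k, hk, hkl⟩ := hex
    have hm : m = (Finset.univ.erase i).card := by simp
    conv_lhs => rw [hm]
    rw [diffDim]
    refine Finset.le_sup (f := Finset.card) (Finset.mem_filter.mpr ⟨Finset.mem_univ _, ?_⟩)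
    intro f hf hfv
    exact key i k hk hkl f hf fun l hl => by simpa using hfv _ hl
  · simpa using hirr.ne_zero
  · simp
  · simpa using hmem
  · -- `key` at the leader of `A` excludes both ways in which a chain could be lower than `A`
    have hlead (v : Fin (m + 1) × ℕ) (hv : IsLeader rk A v) (f : DiffPoly (Fin (m + 1)) K)
        (hf : f ∈ implicitIdeal P) (hfv : ∀ l, (v.1, v.2 + l) ∉ f.vars) : f = 0 := by
      refine key v.1 v.2 (Finsupp.mem_support_iff.mp (hvars ▸ hv.1)) (fun l hl => ?_) f hf hfv
      by_contra hne
      rcases hv.2 (v.1, l) (hvars ▸ Finsupp.mem_support_iff.mpr hne) with e | hlt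
      · exact hl.ne' (congrArg Prod.snd e)
      · refine rk.irrefl v (rk.trans _ _ _ ?_ hlt)
        obtain ⟨l, rfl⟩ := Nat.exists_eq_add_of_lt hl
        exact rk.lt_add v l
    have hdeg (v : Fin (m + 1) × ℕ) : degreeOf v A ≤ 1 :=
      (degreeOf_le_totalDegree _ _).trans (totalDegree_C_add_linForm_le _ _)
    rintro B ⟨hB0, hBp⟩ hBI (⟨k, hkB, hkA, -, hlt⟩ | ⟨hlen, heq⟩)
    · obtain rfl : k = 0 := by simpa using hkA
      have hb0 := hB0 _ (List.getElem_mem hkB)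
      have hbI := hBI _ (List.getElem_mem hkB)
      simp only [List.getElem_cons_zero] at hlt
      rcases hlt with ⟨hv, -⟩ | ⟨v, w, hv, hw, hlt | ⟨rfl, hlt⟩⟩
      · exact hb0 (eq_zero_of_mem_implicitIdeal hh (T := ∅)
          (fun b hb _ => by simpa using hb) hbI (by simp [hv]))
      · refine hb0 (hlead w hw _ hbI fun l hl => ?_)
        have h1 : rk.lt (w.1, w.2 + l) w := by
          rcases hv.2 _ hl with e | h1
          · rwa [e]
          · exact rk.trans _ _ _ h1 hlt
        cases l with
        | zero => exact rk.irrefl _ h1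
        | succ l => exact rk.irrefl _ (rk.trans _ _ _ h1 (rk.lt_add w l))
      · have h0 : degreeOf v B[0] = 0 := by have := hdeg v; omega
        exact (mem_vars_iff_degreeOf_ne_zero.mp hv.1) h0
    · have hlen : 1 < B.length := hlen
      have hred := (List.pairwise_iff_getElem.mp hBp 0 1 (by omega) hlen zero_lt_one).2
      obtain ⟨v, hv, hvl, hvd⟩ := hred
      obtain ⟨-, h0⟩ | ⟨w, hw, hwA, hwd⟩ := heq 0 (by simp)
      · simp only [List.getElem_cons_zero, hvars] at h0
        exact hc0 (Finsupp.support_eq_empty.mp h0)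
      simp only [List.getElem_cons_zero] at hwA hwd
      obtain rfl : v = w := by
        rcases hw.2 v hv.1 with e | h1
        · exact e
        · rcases hv.2 w hw.1 with e | h2
          · exact e.symm
          · exact absurd (rk.trans _ _ _ h1 h2) (rk.irrefl _)
      refine hB0 _ (List.getElem_mem hlen) (hlead v hwA _ (hBI _ (List.getElem_mem hlen)) ?_)
      intro l hl
      rcases Nat.eq_zero_or_pos l with rfl | hl0
      · have h0 : degreeOf v B[1] = 0 := by have := hdeg v; omega
        exact (mem_vars_iff_degreeOf_ne_zero.mp hl) h0
      · exact hvl l hl0 hl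

end Implicit

/-! ### The two resultants -/

section Main

variable {K : Type*} [Field K] [Differential K] {m : ℕ} {P : Fin (m + 1) → DiffPoly (Fin m) K}

/-- A nonvanishing complete resultant that involves all parameters is an implicit equation. -/
theorem isImplicitEquation_cres_of_cres_ne_zero (hP : ∀ i, (P i).totalDegree ≤ 1)
    (hγ : ∀ j, gammaAt (homPart P) j + gamma (homPart P) ≤ totalOrder (homPart P))
    (hne : cres (eqPoly P) ≠ 0) : IsImplicitEquation P (cres (eqPoly P)) := by
  obtain ⟨h, hh⟩ := exists_homPart_eq_linForm P hP
  obtain ⟨hc0, hsum, hfull⟩ := full_rank_of_cres_ne_zero hh hne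
  have hr := order_add_gamma_le (homPart P) 0 (fun j => by linarith [hγ j]) (by rw [hsum]; simp)
  have hc := prolong_resVec hh hr
  rw [cres_eqPoly_eq hh]
  refine isImplicitEquation_of_prolong_eq_zero hh hc hc0 fun i k hk hkl b hb hbi => ?_
  refine eq_zero_of_prolong_eq_zero (by simp) (apply_eq_zero_of_colBound_lt hh hr) hsum
    (fun j => ?_) (supported_below_le_map_prolong hh hr hfull) hc (rowVec_mem _) hk hkl hb hbi
  have := hγ j
  simp only [colBound]
  omega

/-- A nonvanishing homogeneous resultant that involves all parameters makes the substitution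
surjective, already one order below the bounds of the complete resultant, so that the complete
resultant does not vanish either. -/
theorem cres_ne_zero_of_cresHom_ne_zero (hP : ∀ i, (P i).totalDegree ≤ 1)
    (hγ : ∀ j, gammaAt (homPart P) j + gamma (homPart P) < totalOrder (homPart P))
    (hne : cresHom (homPart P) ≠ 0) : cres (eqPoly P) ≠ 0 := by
  obtain ⟨h, hh⟩ := exists_homPart_eq_linForm P hP
  obtain ⟨hcard, hfull⟩ := (orderedDet_ne_zero_iff _).mp hne
  rw [card_rowSet, card_varSet] at hcard
  have hr := order_add_gamma_le (homPart P) 1 (fun j => by linarith [hγ j]) (by rw [hcard]; simp)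
  have hrow (i : Fin (m + 1)) : rowBound (homPart P) 0 i = rowBound (homPart P) 1 i + 1 := by
    have := hr i
    simp only [rowBound]
    omega
  have hcol (j : Fin m) : colBound (homPart P) 0 j = colBound (homPart P) 1 j + 1 := by
    have := hγ j
    simp only [colBound]
    omega
  refine cres_ne_zero hh (fun i => by linarith [hr i]) ?_ ?_
  · simp only [hrow, hcol, Finset.sum_add_distrib, hcard, Finset.sum_const, Finset.card_univ,
      Fintype.card_fin, smul_eq_mul, mul_one]
    ring
  · rw [funext hrow, funext hcol]
    refine supported_below_le_map_prolong_succ (fun j => ?_)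
      (supported_below_le_map_prolong hh hr hfull)
    have := hγ j
    simp only [colBound]
    omega

end Main

end

end DiffAlg

theorem mainTheorem1 {K : Type*} [Field K] [Differential K] {m : ℕ}
    (P : Fin (m + 1) → DiffAlg.DiffPoly (Fin m) K) (hP : ∀ i, (P i).totalDegree ≤ 1) :
    ((∀ j, DiffAlg.gammaAt (DiffAlg.homPart P) j + DiffAlg.gamma (DiffAlg.homPart P)
          < DiffAlg.totalOrder (DiffAlg.homPart P)) →
        DiffAlg.cresHom (DiffAlg.homPart P) ≠ 0 →
          DiffAlg.IsImplicitEquation P (DiffAlg.cres (DiffAlg.eqPoly P))) ∧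
      ((∀ j, DiffAlg.gammaAt (DiffAlg.eqPoly P) j + DiffAlg.gamma (DiffAlg.eqPoly P)
          ≤ DiffAlg.totalOrder (DiffAlg.eqPoly P)) →
        DiffAlg.cres (DiffAlg.eqPoly P) ≠ 0 →
          DiffAlg.IsImplicitEquation P (DiffAlg.cres (DiffAlg.eqPoly P))) := by
  refine ⟨fun hγ hne => ?_, fun hγ hne => ?_⟩
  · exact DiffAlg.isImplicitEquation_cres_of_cres_ne_zero hP (fun j => (hγ j).le)
      (DiffAlg.cres_ne_zero_of_cresHom_ne_zero hP hγ hne)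
  · simp only [DiffAlg.gammaAt_eqPoly, DiffAlg.gamma_eqPoly, DiffAlg.totalOrder_eqPoly] at hγ
    exact DiffAlg.isImplicitEquation_cres_of_cres_ne_zero hP hγ hne
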